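/- Let $V$ be a countable set. An ideal over $V$ is a family of subsets of $V$ that contains all finite sets and is closed under subsets and finite unions; it is non-trivial if it is not $\mathcal P(V)$, and $F_\sigma$ if it is an $F_\sigma$ subset of $\{0,1\}^V$ via characteristic functions. A lower semicontinuous submeasure on $V$ is a function $\varphi:\mathcal P(V)\to[0,\infty]$ with $\varphi(\emptyset)=0$, $\varphi(A)\le\varphi(A\cup B)\le\varphi(A)+\varphi(B)$, $\varphi(\{v\})<\infty$ for $v\in V$, and $\varphi(A)=\sup\{\varphi(F): F\subseteq A\text{ finite}\}$; it is non-pathological if it is the supremum of all $\sigma$-additive measures on $\mathcal P(V)$ that it dominates. An $F_\sigma$ ideal is non-pathological if it equals $\{A:\varphi(A)<\infty\}$ for some non-pathological lower semicontinuous submeasure $\varphi$, and pathological otherwise. An ideal is super-pathological if every non-trivial $F_\sigma$ ideal that contains it is pathological. For a coloring $c:[V]^d\to\{0,1\}$, a set $A\subseteq V$ is $c$-homogeneous if $c$ is constant on $[A]^d$ (sets with fewer than $d$ elements are homogeneous), and the $c$-coloring ideal is the ideal generated by the $c$-homogeneous sets. For a $d$-uniform hypergraph on $V$, a set $A\subseteq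 V$ is complete if every $d$-element subset of $A$ is a hyperedge, and independent if none is; the ideal generated by the hypergraph is the ideal generated by its complete sets and its independent sets. For integers $p\ge 2$, $n\ge 1$, a real $0<\delta<1$ and a set $X_n$ with $n$ elements, let $$\mathcal S_{\delta,p}(n)=\Big\{A\subseteq X_n:\ \tfrac{1-\delta}{p}\,n\le \#A\le \tfrac{1+\delta}{p}\,n\Big\},\qquad V=\bigsqcup_{n\ge1}\mathcal S_{\delta,p}(n).$$ For $\mathcal A\subseteq \mathcal S_{\delta,p}(n)$ let $\psi_n(\mathcal A)$ be the least size of a set $F\subseteq X_n$ such that every $A\in\mathcal A$ omits some point of $F$, and for $\mathcal A\subseteq V$ let $\psi(\mathcal A)=\sup_{n\ge 1}\psi_n(\mathcal A\cap\mathcal S_{\delta,p}(n))$. The Mazur coloring $c=c_{(1-\delta)/p,(1+\delta)/p,p+1}:[V]^{p+1}\to\{0,1\}$ is given by $c(\mathcal A)=1$ if $\psi(\mathcal A)=1$ (equivalently, if for no $n$ the family $\mathcal A\cap\mathcal S_{\delta,p}(n)$ covers $X_n$), and $c(\mathcal A)=0$ otherwise. Let $\mathcal M_{p,\delta}$ be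 the $(p+1)$-uniform hypergraph on $V$ whose hyperedges are the $\mathcal A\in[V]^{p+1}$ with $c(\mathcal A)=0$. **Corollary.** For every integer $p\ge2$ and every real $0<\delta<1$, the $c$-coloring ideal of the Mazur coloring $c_{(1-\delta)/p,(1+\delta)/p,p+1}$ is non-trivial and super-pathological. Moreover, the $(p+1)$-uniform hypergraph $\mathcal M_{p,\delta}$ forbids some finite complete $(p+1)$-uniform hypergraph (there is $k\in\mathbb N$ such that no $k$-element set of vertices is complete for $\mathcal M_{p,\delta}$), and the ideal it generates is a non-trivial super-pathological $F_\sigma$ ideal. -/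

import Mathlib

open scoped ENNReal

noncomputable section

namespace ColoringIdeals

/-! ### Ideals of sets, `F_σ` ideals, pathology -/

/-- An ideal over the set `X`: a family of subsets of `X` which contains all finite sets and is
closed under subsets and finite unions. The improper family of all subsets is allowed. -/
structure IsIdeal {X : Type} (I : Set (Set X)) : Prop where
  finite_mem : ∀ A : Set X, A.Finite → A ∈ I
  subset_mem : ∀ A B : Set X, B ∈ I → A ⊆ B → A ∈ I
  union_mem : ∀ A B : Set X, A ∈ I → B ∈ I → A ∪ B ∈ I

/-- An ideal is non-trivial if it is not the family of all subsets. -/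
def IsNontrivial {X : Type} (I : Set (Set X)) : Prop := I ≠ Set.univ

/-- The ideal generated by a family of sets: the smallest ideal containing it. -/
def generatedIdeal {X : Type} (K : Set (Set X)) : Set (Set X) :=
  ⋂₀ {I : Set (Set X) | IsIdeal I ∧ K ⊆ I}

/-- The families of subsets of `X` that are `F_σ`: via characteristic functions they are countable
unions of closed subsets of `{0,1}^X` with the product topology. -/
def IsFSigma {X : Type} (I : Set (Set X)) : Prop :=
  ∃ C : ℕ → Set (X → Bool), (∀ n, IsClosed (C n)) ∧
    {χ : X → Bool | {x | χ x = true} ∈ I} = ⋃ n, C n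

/-- Lower semicontinuous submeasures on a countable set `X`. -/
structure IsLscSubmeasure {X : Type} (φ : Set X → ℝ≥0∞) : Prop where
  empty : φ ∅ = 0
  mono : ∀ A B : Set X, φ A ≤ φ (A ∪ B)
  subadditive : ∀ A B : Set X, φ (A ∪ B) ≤ φ A + φ B
  singleton_lt_top : ∀ x : X, φ {x} < ⊤
  /-- Lower semicontinuity; for a monotone `φ` on a countable set this says that `φ A` is the limit
  of the values of `φ` on the finite initial parts of `A` in an enumeration of the set. -/
  lsc : ∀ A : Set X, φ A = ⨆ (F : Finset X) (_ : (F : Set X) ⊆ A), φ F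

/-- `Fin(φ)`, the family of all sets of finite submeasure. -/
def finIdeal {X : Type} (φ : Set X → ℝ≥0∞) : Set (Set X) := {A | φ A < ⊤}

/-- A submeasure is non-pathological if it is the supremum of all the `σ`-additive measures,
defined on all subsets of `X`, that it dominates. -/
def IsNonpathologicalSubmeasure {X : Type} (φ : Set X → ℝ≥0∞) : Prop :=
  ∀ A : Set X, φ A =
    ⨆ (μ : @MeasureTheory.Measure X ⊤) (_ : ∀ B : Set X, μ B ≤ φ B), μ A

/-- An ideal is non-pathological if it is `Fin(φ)` for a non-pathological lower semicontinuous
submeasure `φ`. -/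
def IsNonpathological {X : Type} (I : Set (Set X)) : Prop :=
  ∃ φ : Set X → ℝ≥0∞,
    IsLscSubmeasure φ ∧ IsNonpathologicalSubmeasure φ ∧ I = finIdeal φ

/-- An ideal is super-pathological if every non-trivial `F_σ` ideal that covers it is
pathological. -/
def IsSuperPathological {X : Type} (I : Set (Set X)) : Prop :=
  ∀ J : Set (Set X), IsIdeal J → IsFSigma J → IsNontrivial J → I ⊆ J → ¬ IsNonpathological J

/-! ### Colorings of `[X]^d`, homogeneous sets, hypergraphs -/

/-- `hom_i(c)`: the sets `A` such that `c` is constant with value `i` on `[A]^d`. -/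
def homSets {X : Type} {d r : ℕ} (c : Set.powersetCard X d → Fin r) (i : Fin r) : Set (Set X) :=
  {A | ∀ s : Set.powersetCard X d, ((s : Finset X) : Set X) ⊆ A → c s = i}

/-- The `c`-coloring ideal `⟨hom(c)⟩`, generated by the homogeneous sets of all colors. -/
def coloringIdeal {X : Type} {d r : ℕ} (c : Set.powersetCard X d → Fin r) : Set (Set X) :=
  generatedIdeal (⋃ i, homSets c i)

/-- The hypergraph `H_i(c)` on `X` whose hyperedges are the sets with color `i`. -/
def colorHypergraph {X : Type} {d r : ℕ} (c : Set.powersetCard X d → Fin r) (i : Fin r) :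
    Hypergraph X where
  vertexSet := Set.univ
  edgeSet := {e | ∃ s : Set.powersetCard X d, c s = i ∧ e = ((s : Finset X) : Set X)}
  subset_vertexSet_of_mem_edgeSet' := fun _ _ => Set.subset_univ _

/-- All hyperedges have exactly `d` elements. -/
def IsUniform {X : Type} (H : Hypergraph X) (d : ℕ) : Prop :=
  ∀ e ∈ H.edgeSet, e.encard = d

/-- A set of vertices is complete for a `d`-uniform hypergraph if all its `d`-element subsets are
hyperedges. -/
def IsComplete {X : Type} (H : Hypergraph X) (d : ℕ) (A : Set X) : Prop :=
  A ⊆ H.vertexSet ∧ ∀ e ⊆ A, e.encard = d → e ∈ H.edgeSet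

/-- A set of vertices is independent for a `d`-uniform hypergraph if none of its `d`-element
subsets is a hyperedge. -/
def IsIndependent {X : Type} (H : Hypergraph X) (d : ℕ) (A : Set X) : Prop :=
  A ⊆ H.vertexSet ∧ ∀ e ⊆ A, e.encard = d → e ∉ H.edgeSet

/-- `H` does not contain the complete `d`-uniform hypergraph on `k` vertices. -/
def ForbidsComplete {X : Type} (H : Hypergraph X) (d k : ℕ) : Prop :=
  ∀ A : Set X, A.encard = k → ¬ IsComplete H d A

/-- The ideal generated by a `d`-uniform hypergraph with vertex set the whole of `X`: it is
generated by the complete and the independent sets. -/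
def hypergraphIdeal {X : Type} (H : Hypergraph X) (d : ℕ) : Set (Set X) :=
  generatedIdeal {A | IsComplete H d A ∨ IsIndependent H d A}

/-! ### Mazur colorings -/

/-- The cardinal interval `X^{[α,β]}`. -/
def cardInterval (X : Type) [Fintype X] (α β : ℝ) : Set (Finset X) :=
  {A | α * Fintype.card X ≤ A.card ∧ (A.card : ℝ) ≤ β * Fintype.card X}

/-- The covering submeasure `ψ_X`: the least size of a set `F ⊆ X` such that every member of the
family `𝒜` omits some point of `F` (and `⊤` if there is no such `F`). -/
def coveringSubmeasure (X : Type) (𝒜 : Set (Finset X)) : ℕ∞ :=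
  ⨅ (F : Finset X) (_ : ∀ A ∈ 𝒜, ∃ x ∈ F, x ∉ A), (F.card : ℕ∞)

/-- The disjoint union `𝔛 = ⊔_n X_n^{[α,β]}`. -/
abbrev AmalgamatedInterval (X : ℕ → Type) [∀ n, Fintype (X n)] (α β : ℝ) : Type :=
  Σ n : ℕ, cardInterval (X n) α β

/-- The submeasure `ψ(𝒜) = sup_n ψ_{X_n}(𝒜 ∩ 𝔛_n)`. -/
def amalgamatedSubmeasure (X : ℕ → Type) [∀ n, Fintype (X n)] (α β : ℝ)
    (𝒜 : Set (AmalgamatedInterval X α β)) : ℕ∞ :=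
  ⨆ n, coveringSubmeasure (X n) {A | ∃ h : A ∈ cardInterval (X n) α β, ⟨n, A, h⟩ ∈ 𝒜}

open Classical in
/-- The Mazur coloring `c_{α,β,d}` of `[𝔛]^d`: the color is `1` if `ψ` is `1`, and `0` otherwise. -/
def mazurColoring (X : ℕ → Type) [∀ n, Fintype (X n)] (α β : ℝ) (d : ℕ) :
    Set.powersetCard (AmalgamatedInterval X α β) d → Fin 2 :=
  fun 𝒜 => if amalgamatedSubmeasure X α β ((𝒜 : Finset (AmalgamatedInterval X α β)) :
    Set (AmalgamatedInterval X α β)) = 1 then 1 else 0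

/-- The Mazur coloring `c_{(1-δ)/p,(1+δ)/p,p+1}` of `[⊔_n S_{δ,p}(n)]^{p+1}`, where `S_{δ,p}(n)` is
the symmetric cardinal interval of an `n`-element set and `n` runs over the positive integers. -/
def symmetricMazurColoring (p : ℕ) (δ : ℝ) :
    Set.powersetCard
      (AmalgamatedInterval (fun n : ℕ => Fin (n + 1)) ((1 - δ) / p) ((1 + δ) / p)) (p + 1) → Fin 2 :=
  mazurColoring (fun n : ℕ => Fin (n + 1)) ((1 - δ) / p) ((1 + δ) / p) (p + 1)

/-- The hypergraph `M_{p,δ}`: the sets of color `0` of the above coloring. -/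
def mazurHypergraph (p : ℕ) (δ : ℝ) :
    Hypergraph (AmalgamatedInterval (fun n : ℕ => Fin (n + 1)) ((1 - δ) / p) ((1 + δ) / p)) :=
  colorHypergraph (symmetricMazurColoring p δ) 0

end ColoringIdeals

end

namespace ColoringIdeals

/-! ### Covering families and independent sets -/

/-! Color 0 means that the family covers some ground set. Complete sets are finite, because members
omitting a common point cannot help to cover it (`IsComplete.finite`). Hence the ideal consists of
the subsets of finite unions of cover-free sets. Cover-freeness is hereditary and closed, so
compactness makes the ideal `F_σ`.

Super-pathology: each set `omitting x` is cover-free, so a submeasure `φ` whose ideal contains the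
given one is finite on all of them, and Baire category bounds it there by one `M`. Every vertex
omits at least the fraction `1 - β` of its ground set. Averaging over `x` then gives `(1 - β) μ(F) ≤
M` for each measure `μ ≤ φ` and finite `F`. If `φ` is non-pathological, it is therefore bounded by
`M / (1 - β)`, and its ideal is trivial.

Non-triviality (`sUnion_coverFree_ne_univ`): use the permutations of `Fin N` as ground set. For a
set `s` of `m = p * q` points, the permutations whose minimum on `s` sits at a rank divisible by `p`
or among the last `p` ranks form a proportion between `1/p` and `(1 + p/q)/p`, so they are a vertex
once `p ≤ δ q`. If finitely many cover-free sets exhausted the vertices, an ultrafilter limit in `N`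
and Ramsey's theorem would put the vertices of `p` consecutive windows of length `m` into one of
them. These cover: wherever a permutation has its minimum, some window sees it at a good rank. -/

/-- The vertices of the Mazur hypergraphs. -/
abbrev Vertex (α β : ℝ) : Type := AmalgamatedInterval (fun n : ℕ => Fin (n + 1)) α β

/-- For some `n`, the members of the family that are subsets of `Fin (n + 1)` cover it. -/
def Covers {α β : ℝ} (s : Set (Vertex α β)) : Prop :=
  ∃ n : ℕ, ∀ x : Fin (n + 1), ∃ A : cardInterval (Fin (n + 1)) α β, ⟨n, A⟩ ∈ s ∧ x ∈ A.1

/-- No `d` elements of the set form a covering family. -/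
def CoverFree {α β : ℝ} (d : ℕ) (B : Set (Vertex α β)) : Prop :=
  ∀ s : Finset (Vertex α β), s.card = d → (s : Set (Vertex α β)) ⊆ B →
    ¬ Covers (s : Set (Vertex α β))

theorem CoverFree.mono {α β : ℝ} {d : ℕ} {A B : Set (Vertex α β)} (hB : CoverFree d B)
    (h : A ⊆ B) : CoverFree d A :=
  fun s hs hsA => hB s hs (hsA.trans h)

theorem Covers.mono {α β : ℝ} {A B : Set (Vertex α β)} (hA : Covers A) (h : A ⊆ B) :
    Covers B := by
  obtain ⟨n, hn⟩ := hA
  refine ⟨n, fun x => ?_⟩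
  obtain ⟨a, ha, hx⟩ := hn x
  exact ⟨a, h ha, hx⟩

/-! ### Color 0 is covering -/

theorem coveringSubmeasure_le_one {X : Type} {𝒜 : Set (Finset X)} {x : X}
    (h : ∀ A ∈ 𝒜, x ∉ A) : coveringSubmeasure X 𝒜 ≤ 1 := by
  refine (iInf₂_le ({x} : Finset X) fun A hA => ⟨x, by simp, h A hA⟩).trans ?_
  simp

theorem one_le_coveringSubmeasure {X : Type} {𝒜 : Set (Finset X)} (h : 𝒜.Nonempty) :
    1 ≤ coveringSubmeasure X 𝒜 := by
  refine le_iInf₂ fun F hF => ?_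
  obtain ⟨A, hA⟩ := h
  obtain ⟨x, hx, -⟩ := hF A hA
  exact_mod_cast Finset.card_pos.2 ⟨x, hx⟩

theorem two_le_coveringSubmeasure {X : Type} [Nonempty X] {𝒜 : Set (Finset X)}
    (h : ∀ x, ∃ A ∈ 𝒜, x ∈ A) : 2 ≤ coveringSubmeasure X 𝒜 := by
  refine le_iInf₂ fun F hF => ?_
  obtain ⟨A, hA, -⟩ := h (Classical.arbitrary X)
  obtain ⟨x, hx, -⟩ := hF A hA
  obtain ⟨B, hB, hxB⟩ := h x
  obtain ⟨y, hy, hyB⟩ := hF B hB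
  have : 1 < F.card := Finset.one_lt_card.2 ⟨x, hx, y, hy, fun e => hyB (e ▸ hxB)⟩
  exact_mod_cast this

/-- A one-point `F` is admissible on a level exactly when its point lies in no member there. The
empty `F` is admissible only for an empty family, so nonemptiness of `s` excludes the value 0. -/
theorem amalgamatedSubmeasure_eq_one_iff {α β : ℝ} {s : Set (Vertex α β)} (hs : s.Nonempty) :
    amalgamatedSubmeasure (fun n : ℕ => Fin (n + 1)) α β s = 1 ↔ ¬ Covers s := by
  constructor
  · rintro h ⟨n, hn⟩
    have h2 : (2 : ℕ∞) ≤ amalgamatedSubmeasure (fun n : ℕ => Fin (n + 1)) α β s := by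
      unfold amalgamatedSubmeasure
      refine le_iSup_of_le n (two_le_coveringSubmeasure fun x => ?_)
      obtain ⟨A, hA, hx⟩ := hn x
      exact ⟨A.1, ⟨A.2, hA⟩, hx⟩
    rw [h] at h2
    exact absurd h2 (by decide)
  · intro h
    refine le_antisymm (iSup_le fun n => ?_) ?_
    · have : ∃ x : Fin (n + 1), ∀ A : cardInterval (Fin (n + 1)) α β, ⟨n, A⟩ ∈ s → x ∉ A.1 := by
        by_contra hc
        push Not at hc
        exact h ⟨n, hc⟩
      obtain ⟨x, hx⟩ := this
      exact coveringSubmeasure_le_one (x := x) fun A ⟨hA, hAs⟩ => hx ⟨A, hA⟩ hAs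
    · obtain ⟨⟨n, A, hA⟩, hAs⟩ := hs
      unfold amalgamatedSubmeasure
      exact le_iSup_of_le n (one_le_coveringSubmeasure ⟨A, ⟨hA, hAs⟩⟩)

theorem symmetricMazurColoring_eq_zero_iff {p : ℕ} {δ : ℝ}
    (s : Set.powersetCard (Vertex ((1 - δ) / p) ((1 + δ) / p)) (p + 1)) :
    symmetricMazurColoring p δ s = 0 ↔
      Covers ((s : Finset (Vertex ((1 - δ) / p) ((1 + δ) / p))) :
        Set (Vertex ((1 - δ) / p) ((1 + δ) / p))) := by
  have hs : ((s : Finset (Vertex ((1 - δ) / p) ((1 + δ) / p))) :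
        Set (Vertex ((1 - δ) / p) ((1 + δ) / p))).Nonempty := by
    rw [Finset.coe_nonempty, ← Finset.card_pos, Set.powersetCard.card_eq]
    omega
  have := amalgamatedSubmeasure_eq_one_iff hs
  unfold symmetricMazurColoring mazurColoring
  split_ifs with h
  · simp only [Fin.isValue, one_ne_zero, false_iff]
    exact this.1 h
  · simp only [true_iff]
    by_contra hc
    exact h (this.2 hc)

theorem mem_edgeSet_mazurHypergraph_iff {p : ℕ} {δ : ℝ}
    {e : Set (Vertex ((1 - δ) / p) ((1 + δ) / p))} (he : e.encard = (p + 1 : ℕ)) :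
    e ∈ (mazurHypergraph p δ).edgeSet ↔ Covers e := by
  have hfin : e.Finite := Set.finite_of_encard_eq_coe he
  obtain ⟨s, rfl⟩ := hfin.exists_finset_coe
  have hs : s.card = p + 1 := by
    rw [Set.encard_coe_eq_coe_finsetCard] at he
    exact_mod_cast he
  constructor
  · rintro ⟨t, ht, hts⟩
    rw [hts]
    exact (symmetricMazurColoring_eq_zero_iff t).1 ht
  · intro h
    exact ⟨⟨s, hs⟩, (symmetricMazurColoring_eq_zero_iff _).2 h, rfl⟩

theorem isUniform_mazurHypergraph (p : ℕ) (δ : ℝ) :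
    IsUniform (mazurHypergraph p δ) (p + 1) := by
  rintro e ⟨s, -, rfl⟩
  rw [Set.encard_coe_eq_coe_finsetCard, Set.powersetCard.card_eq]

theorem isIndependent_iff_coverFree {p : ℕ} {δ : ℝ}
    {A : Set (Vertex ((1 - δ) / p) ((1 + δ) / p))} :
    IsIndependent (mazurHypergraph p δ) (p + 1) A ↔ CoverFree (p + 1) A := by
  constructor
  · rintro ⟨-, h⟩ s hs hsA hc
    have he : (s : Set (Vertex ((1 - δ) / p) ((1 + δ) / p))).encard = (p + 1 : ℕ) := by
      rw [Set.encard_coe_eq_coe_finsetCard, hs]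
    exact h _ hsA he ((mem_edgeSet_mazurHypergraph_iff he).2 hc)
  · refine fun h => ⟨Set.subset_univ _, fun e heA he hee => ?_⟩
    obtain ⟨s, rfl⟩ := (Set.finite_of_encard_eq_coe he).exists_finset_coe
    have hs : s.card = p + 1 := by
      rw [Set.encard_coe_eq_coe_finsetCard] at he
      exact_mod_cast he
    exact h s hs heA ((mem_edgeSet_mazurHypergraph_iff he).1 hee)

theorem isComplete_iff {p : ℕ} {δ : ℝ}
    {A : Set (Vertex ((1 - δ) / p) ((1 + δ) / p))} :
    IsComplete (mazurHypergraph p δ) (p + 1) A ↔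
      ∀ s : Finset (Vertex ((1 - δ) / p) ((1 + δ) / p)), s.card = p + 1 →
        (s : Set (Vertex ((1 - δ) / p) ((1 + δ) / p))) ⊆ A →
        Covers (s : Set (Vertex ((1 - δ) / p) ((1 + δ) / p))) := by
  constructor
  · rintro ⟨-, h⟩ s hs hsA
    have he : (s : Set (Vertex ((1 - δ) / p) ((1 + δ) / p))).encard = (p + 1 : ℕ) := by
      rw [Set.encard_coe_eq_coe_finsetCard, hs]
    exact (mem_edgeSet_mazurHypergraph_iff he).1 (h _ hsA he)
  · refine fun h => ⟨Set.subset_univ _, fun e heA he => ?_⟩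
    obtain ⟨s, rfl⟩ := (Set.finite_of_encard_eq_coe he).exists_finset_coe
    have hs : s.card = p + 1 := by
      rw [Set.encard_coe_eq_coe_finsetCard] at he
      exact_mod_cast he
    exact (mem_edgeSet_mazurHypergraph_iff he).2 (h s hs heA)

theorem coloringIdeal_symmetricMazurColoring (p : ℕ) (δ : ℝ) :
    coloringIdeal (symmetricMazurColoring p δ) =
      hypergraphIdeal (mazurHypergraph p δ) (p + 1) := by
  unfold coloringIdeal hypergraphIdeal
  congr 1
  ext A
  simp only [Set.mem_iUnion, Fin.exists_fin_two, Set.mem_ofPred_eq, isComplete_iff,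
    isIndependent_iff_coverFree, homSets]
  refine or_congr ⟨fun h s hs hsA => ?_, fun h s hsA => ?_⟩
    ⟨fun h s hs hsA hc => ?_, fun h s hsA => ?_⟩
  · exact (symmetricMazurColoring_eq_zero_iff ⟨s, hs⟩).1 (h ⟨s, hs⟩ hsA)
  · exact (symmetricMazurColoring_eq_zero_iff s).2 (h s s.2 hsA)
  · have h1 := h ⟨s, hs⟩ hsA
    rw [(symmetricMazurColoring_eq_zero_iff ⟨s, hs⟩).2 hc] at h1
    exact zero_ne_one h1
  · have h1 : symmetricMazurColoring p δ s ≠ 0 := fun h0 =>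
      h s s.2 hsA ((symmetricMazurColoring_eq_zero_iff s).1 h0)
    omega

/-! ### Complete sets are bounded -/

theorem one_sub_mul_le_card_compl {X : Type} [Fintype X] [DecidableEq X] {α β : ℝ}
    {A : Finset X} (hA : A ∈ cardInterval X α β) :
    (1 - β) * Fintype.card X ≤ (Aᶜ.card : ℝ) := by
  rw [Finset.card_compl, Nat.cast_sub (Finset.card_le_univ A)]
  linarith [hA.2]

theorem exists_notMem {n : ℕ} {α β : ℝ} (hβ : β < 1) (A : cardInterval (Fin (n + 1)) α β) :
    ∃ x, x ∉ A.1 := by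
  have h := one_sub_mul_le_card_compl A.2
  have h2 : (0 : ℝ) < (A.1ᶜ.card : ℝ) := by
    refine lt_of_lt_of_le (mul_pos (by linarith) ?_) h
    simp only [Fintype.card_fin]; positivity
  obtain ⟨x, hx⟩ := Finset.card_pos.1 (by exact_mod_cast h2)
  exact ⟨x, by simpa using hx⟩

/-- Double counting of pairs (member, omitted point): a point is omitted by at most `p` members,
since `p + 1` of them would not cover it, while each member omits at least `(1 - β)(n + 1)` points.
-/
theorem card_fiber_le_of_covers {α β : ℝ} {p n : ℕ}
    (G : Finset (Vertex α β)) (hG : ∀ a ∈ G, a.1 = n)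
    (h : ∀ s ⊆ G, s.card = p + 1 → Covers (s : Set (Vertex α β))) :
    (1 - β) * G.card ≤ p := by
  classical
  -- Points are compared through their values in `ℕ`, since `a.1 = n` holds only propositionally.
  have key : ∀ x : Fin (n + 1),
      (G.filter fun a => ∀ y : Fin (a.1 + 1), y ∈ a.2.1 → (y : ℕ) ≠ x).card ≤ p := by
    intro x
    by_contra hc
    push Not at hc
    obtain ⟨s, hs, hcard⟩ := Finset.exists_subset_card_eq (Nat.succ_le_of_lt hc)
    obtain ⟨m, hm⟩ := h s (hs.trans (Finset.filter_subset _ _)) hcard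
    -- The point 0 only serves to show that the covered level is `n`.
    obtain ⟨A, hA, -⟩ := hm 0
    have : m = n := hG _ ((hs.trans (Finset.filter_subset _ _)) hA)
    subst this
    obtain ⟨A, hA, hx⟩ := hm x
    exact (Finset.mem_filter.1 (hs hA)).2 x hx rfl
  have hcount : ∑ a ∈ G, (Finset.univ.filter fun x : Fin (n + 1) =>
        ∀ y : Fin (a.1 + 1), y ∈ a.2.1 → (y : ℕ) ≠ x).card
      ≤ (n + 1) * p := by
    have := Finset.sum_card_bipartiteAbove_eq_sum_card_bipartiteBelow (s := G)
      (t := (Finset.univ : Finset (Fin (n + 1))))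
      (fun a (x : Fin (n + 1)) => ∀ y : Fin (a.1 + 1), y ∈ a.2.1 → (y : ℕ) ≠ x)
    unfold Finset.bipartiteAbove Finset.bipartiteBelow at this
    rw [this]
    refine (Finset.sum_le_card_nsmul _ _ p fun x _ => key x).trans ?_
    simp
  have hlow : ∀ a ∈ G, (1 - β) * (n + 1) ≤
      ((Finset.univ.filter fun x : Fin (n + 1) =>
        ∀ y : Fin (a.1 + 1), y ∈ a.2.1 → (y : ℕ) ≠ x).card : ℝ) := by
    rintro ⟨m, A⟩ ha
    obtain rfl : m = n := hG _ ha
    have h1 := one_sub_mul_le_card_compl A.2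
    simp only [Fintype.card_fin, Nat.cast_add, Nat.cast_one] at h1
    refine h1.trans (le_of_eq ?_)
    congr 2
    ext x
    simp only [Finset.mem_compl, Finset.mem_filter, Finset.mem_univ, true_and]
    exact ⟨fun hx y hy e => hx (Fin.ext e ▸ hy), fun hx hx' => hx x hx' rfl⟩
  have h3 : (G.card : ℝ) * ((1 - β) * (n + 1)) ≤ (n + 1) * p := by
    have h4 := Finset.card_nsmul_le_sum G _ _ hlow
    rw [nsmul_eq_mul] at h4
    exact h4.trans (by exact_mod_cast hcount)
  have hn : (0 : ℝ) < n + 1 := by positivity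
  nlinarith

/-- Take one member from each of `p + 1` levels: a covered level would be covered by a single set,
which `β < 1` forbids. -/
theorem card_image_fst_le_of_covers {α β : ℝ} (hβ : β < 1) {p : ℕ}
    (G : Finset (Vertex α β))
    (h : ∀ s ⊆ G, s.card = p + 1 → Covers (s : Set (Vertex α β))) :
    (G.image Sigma.fst).card ≤ p := by
  classical
  by_contra hc
  push Not at hc
  obtain ⟨I, hI, hcard⟩ := Finset.exists_subset_card_eq (Nat.succ_le_of_lt hc)
  have hex : ∀ i : I, ∃ a ∈ G, a.1 = i := fun i => by
    simpa only [Finset.mem_image] using hI i.2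
  choose f hf hfi using hex
  have hinj : Function.Injective f := fun i j e => Subtype.ext (by rw [← hfi, ← hfi, e])
  obtain ⟨m, hm⟩ := h (Finset.univ.image f) (by
    intro a ha
    obtain ⟨i, -, rfl⟩ := Finset.mem_image.1 ha
    exact hf i) (by
    rw [Finset.card_image_of_injective _ hinj, Finset.card_univ, Fintype.card_coe, hcard])
  obtain ⟨A, hA, -⟩ := hm 0
  obtain ⟨x, hx⟩ := exists_notMem hβ A
  obtain ⟨B, hB, hxB⟩ := hm x
  obtain ⟨i, -, hi⟩ := Finset.mem_image.1 (Finset.mem_coe.1 hA)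
  obtain ⟨j, -, hj⟩ := Finset.mem_image.1 (Finset.mem_coe.1 hB)
  have hij : i = j := Subtype.ext (by rw [← hfi, ← hfi, hi, hj])
  subst hij
  rw [hi] at hj
  have : A = B := by simpa using hj
  exact hx (this ▸ hxB)

theorem exists_card_le_of_covers {α β : ℝ} (hβ : β < 1) (p : ℕ) :
    ∃ K : ℕ, ∀ G : Finset (Vertex α β),
      (∀ s ⊆ G, s.card = p + 1 → Covers (s : Set (Vertex α β))) → G.card ≤ K := by
  classical
  -- At most `p / (1 - β)` members on each of at most `p` levels.
  refine ⟨⌊(p : ℝ) / (1 - β)⌋₊ * p, fun G hG => ?_⟩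
  refine (Finset.card_le_mul_card_image (f := Sigma.fst) G ⌊(p : ℝ) / (1 - β)⌋₊
    fun n _ => ?_).trans (Nat.mul_le_mul_left _ (card_image_fst_le_of_covers hβ G hG))
  refine Nat.le_floor ?_
  rw [le_div_iff₀ (by linarith), mul_comm]
  exact card_fiber_le_of_covers _ (fun a ha => (Finset.mem_filter.1 ha).2)
    fun s hs => hG s (hs.trans (Finset.filter_subset _ _))

theorem exists_forbidsComplete {p : ℕ} {δ : ℝ} (hβ : (1 + δ) / p < 1) :
    ∃ k : ℕ, ForbidsComplete (mazurHypergraph p δ) (p + 1) k := by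
  obtain ⟨K, hK⟩ := exists_card_le_of_covers (α := (1 - δ) / p) hβ p
  refine ⟨K + 1, fun A hA hc => ?_⟩
  obtain ⟨G, rfl⟩ := (Set.finite_of_encard_eq_coe hA).exists_finset_coe
  rw [Set.encard_coe_eq_coe_finsetCard] at hA
  have h1 : G.card = K + 1 := by exact_mod_cast hA
  have h2 := hK G fun s hs hcard => isComplete_iff.1 hc s hcard (by exact_mod_cast hs)
  omega

theorem IsComplete.finite {p : ℕ} {δ : ℝ} (hβ : (1 + δ) / p < 1)
    {A : Set (Vertex ((1 - δ) / p) ((1 + δ) / p))}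
    (hA : IsComplete (mazurHypergraph p δ) (p + 1) A) : A.Finite := by
  obtain ⟨K, hK⟩ := exists_card_le_of_covers (α := (1 - δ) / p) hβ p
  by_contra hinf
  obtain ⟨G, hG, hcard⟩ := Set.Infinite.exists_subset_card_eq hinf (K + 1)
  have h2 := hK G fun s hs hc => isComplete_iff.1 hA s hc (subset_trans (by exact_mod_cast hs) hG)
  omega

/-! ### The ideal generated by a hypergraph -/

theorem isIdeal_generatedIdeal {X : Type} (K : Set (Set X)) : IsIdeal (generatedIdeal K) where
  finite_mem := fun A hA _ hI => hI.1.finite_mem A hA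
  subset_mem := fun A B hB hAB I hI => hI.1.subset_mem A B (hB I hI) hAB
  union_mem := fun A B hA hB I hI => hI.1.union_mem A B (hA I hI) (hB I hI)

theorem subset_generatedIdeal {X : Type} (K : Set (Set X)) : K ⊆ generatedIdeal K :=
  fun _ hA _ hI => hI.2 hA

theorem IsIdeal.sUnion_mem {X : Type} {I : Set (Set X)} (hI : IsIdeal I) (S : Finset (Set X))
    (h : ∀ B ∈ S, B ∈ I) : ⋃₀ (S : Set (Set X)) ∈ I := by
  classical
  induction S using Finset.induction_on with
  | empty => simpa using hI.finite_mem ∅ Set.finite_empty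
  | insert B S _ ih =>
    rw [Finset.coe_insert, Set.sUnion_insert]
    exact hI.union_mem _ _ (h B (Finset.mem_insert_self _ _))
      (ih fun C hC => h C (Finset.mem_insert_of_mem hC))

theorem coverFree_of_encard_lt {α β : ℝ} {d : ℕ} {B : Set (Vertex α β)} (h : B.encard < d) :
    CoverFree d B := by
  intro s hs hsB
  have := Set.encard_le_encard hsB
  rw [Set.encard_coe_eq_coe_finsetCard, hs] at this
  exact absurd h (not_lt.2 this)

/-- The bound `2 ≤ d` makes singletons cover-free vacuously, so that finite sets belong. -/
theorem isIdeal_finite_unions {α β : ℝ} {d : ℕ} (hd : 2 ≤ d) :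
    IsIdeal {A : Set (Vertex α β) | ∃ S : Finset (Set (Vertex α β)),
      (∀ B ∈ S, CoverFree d B) ∧ A ⊆ ⋃₀ (S : Set (Set (Vertex α β)))} where
  finite_mem := by
    classical
    intro A hA
    obtain ⟨F, rfl⟩ := hA.exists_finset_coe
    refine ⟨F.image fun a => {a}, fun B hB => ?_, fun a ha => ?_⟩
    · obtain ⟨a, -, rfl⟩ := Finset.mem_image.1 hB
      refine coverFree_of_encard_lt ?_
      rw [Set.encard_singleton]
      exact_mod_cast hd
    · exact ⟨{a}, Finset.mem_coe.2 (Finset.mem_image_of_mem _ ha), rfl⟩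
  subset_mem := fun A B ⟨S, hS, hB⟩ hAB => ⟨S, hS, hAB.trans hB⟩
  union_mem := by
    classical
    rintro A B ⟨S, hS, hA⟩ ⟨T, hT, hB⟩
    refine ⟨S ∪ T, fun C hC => (Finset.mem_union.1 hC).elim (hS C) (hT C), ?_⟩
    rw [Finset.coe_union, Set.sUnion_union]
    exact Set.union_subset_union hA hB

/-- Complete sets are finite and hence add nothing to the ideal generated by the cover-free sets. -/
theorem mem_hypergraphIdeal_iff {p : ℕ} (hp : 1 ≤ p) {δ : ℝ} (hβ : (1 + δ) / p < 1)
    {A : Set (Vertex ((1 - δ) / p) ((1 + δ) / p))} :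
    A ∈ hypergraphIdeal (mazurHypergraph p δ) (p + 1) ↔
      ∃ S : Finset (Set (Vertex ((1 - δ) / p) ((1 + δ) / p))),
        (∀ B ∈ S, CoverFree (p + 1) B) ∧ A ⊆ ⋃₀ (S : Set (Set _)) := by
  have hI := isIdeal_finite_unions (α := (1 - δ) / p) (β := (1 + δ) / p)
    (show 2 ≤ p + 1 by omega)
  constructor
  · refine fun h => h _ ⟨hI, ?_⟩
    rintro B (hB | hB)
    · exact hI.finite_mem B (hB.finite hβ)
    · exact ⟨{B}, fun C hC => by
        rw [Finset.mem_singleton.1 hC]; exact isIndependent_iff_coverFree.1 hB, by simp⟩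
  · rintro ⟨S, hS, hA⟩
    refine (isIdeal_generatedIdeal _).subset_mem _ _
      ((isIdeal_generatedIdeal _).sUnion_mem S fun B hB => ?_) hA
    exact subset_generatedIdeal _ (Or.inr (isIndependent_iff_coverFree.2 (hS B hB)))

/-! ### Compactness and the `F_σ` property -/

theorem isClosed_coverFree {α β : ℝ} (d : ℕ) :
    IsClosed {χ : Vertex α β → Bool | CoverFree d {a | χ a = true}} := by
  have : {χ : Vertex α β → Bool | CoverFree d {a | χ a = true}} =
      ⋂ (s : Finset (Vertex α β)) (_ : s.card = d ∧ Covers (s : Set (Vertex α β))),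
        ⋃ a ∈ s, {χ | χ a = false} := by
    ext χ
    simp only [CoverFree, Set.mem_ofPred_eq, Set.mem_iInter, Set.mem_iUnion]
    refine forall_congr' fun s => ⟨fun h ⟨hs, hc⟩ => ?_, fun h hs hsub hc => ?_⟩
    · by_contra hne
      push Not at hne
      exact h hs (fun a ha => by simpa using hne a ha) hc
    · obtain ⟨a, ha, hf⟩ := h ⟨hs, hc⟩
      have : χ a = true := hsub ha
      simp [hf] at this
  rw [this]
  refine isClosed_iInter fun s => isClosed_iInter fun _ => ?_
  exact s.finite_toSet.isClosed_biUnion fun a _ =>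
    isClosed_eq (continuous_apply a) continuous_const

/-- Unions of `k` cover-free sets form the image of a compact power under a continuous map. By
heredity, inclusion in such a union is the same as equality with one. -/
theorem isFSigma_finite_unions {α β : ℝ} (d : ℕ) :
    IsFSigma {A : Set (Vertex α β) | ∃ S : Finset (Set (Vertex α β)),
      (∀ B ∈ S, CoverFree d B) ∧ A ⊆ ⋃₀ (S : Set (Set (Vertex α β)))} := by
  classical
  let K : Set (Vertex α β → Bool) := {χ | CoverFree d {a | χ a = true}}
  let u (k : ℕ) (f : Fin k → Vertex α β → Bool) : Vertex α β → Bool :=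
    fun a => decide (∃ i, f i a = true)
  have hu : ∀ k, Continuous (u k) := fun k => continuous_pi fun a =>
    (continuous_of_discreteTopology (f := fun g : Fin k → Bool => decide (∃ i, g i = true))).comp
      (continuous_pi fun i => (continuous_apply a).comp (continuous_apply i))
  refine ⟨fun k => u k '' Set.univ.pi fun _ => K, fun k => ?_, ?_⟩
  · exact ((isCompact_univ_pi fun _ => (isClosed_coverFree d).isCompact).image (hu k)).isClosed
  · ext χ
    simp only [Set.mem_ofPred_eq, Set.mem_iUnion, Set.mem_image, Set.mem_univ_pi]
    constructor
    · rintro ⟨S, hS, hχ⟩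
      let e := S.equivFin
      refine ⟨S.card, fun i a => decide (χ a = true ∧ a ∈ (e.symm i : Set (Vertex α β))),
        fun i => (hS _ (e.symm i).2).mono fun a ha => ?_, ?_⟩
      · simp only [Set.mem_ofPred_eq, decide_eq_true_eq] at ha
        exact ha.2
      · funext a
        by_cases ha : χ a = true
        · obtain ⟨B, hB, haB⟩ := hχ ha
          simp only [u, ha, decide_eq_true_eq]
          exact ⟨e ⟨B, hB⟩, by simpa using haB⟩
        · simp [u, ha]
    · rintro ⟨k, f, hf, rfl⟩
      refine ⟨Finset.univ.image fun i => {a | f i a = true}, fun B hB => ?_, fun a ha => ?_⟩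
      · obtain ⟨i, -, rfl⟩ := Finset.mem_image.1 hB
        exact hf i
      · obtain ⟨i, hi⟩ := of_decide_eq_true ha
        exact ⟨_, Finset.mem_coe.2 (Finset.mem_image_of_mem _ (Finset.mem_univ i)), hi⟩

/-! ### Super-pathology -/

/-- The sets that omit the chosen point of the `n`-th ground set. -/
def omitting {α β : ℝ} (x : ∀ n : ℕ, Fin (n + 1)) : Set (Vertex α β) := {a | x a.1 ∉ a.2.1}

theorem coverFree_omitting {α β : ℝ} (d : ℕ) (x : ∀ n : ℕ, Fin (n + 1)) :
    CoverFree d (omitting x : Set (Vertex α β)) := by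
  rintro s - hs ⟨n, hn⟩
  obtain ⟨A, hA, hx⟩ := hn (x n)
  exact hs hA hx

/-- Averaging over `x`: each index keeps its weight for at least a fraction `1 - β` of the points.
-/
theorem exists_le_sum_filter_notMem {X : Type} [Fintype X] [DecidableEq X] [Nonempty X]
    {ι : Type} (G : Finset ι) (A : ι → Finset X) (w : ι → ℝ) (hw : ∀ i, 0 ≤ w i) (β : ℝ)
    (h : ∀ i ∈ G, ((A i).card : ℝ) ≤ β * Fintype.card X) :
    ∃ x, (1 - β) * ∑ i ∈ G, w i ≤ ∑ i ∈ G with x ∉ A i, w i := by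
  have key : ∑ _x : X, (1 - β) * ∑ i ∈ G, w i ≤ ∑ x : X, ∑ i ∈ G with x ∉ A i, w i := by
    simp_rw [Finset.sum_filter]
    rw [Finset.sum_comm, Finset.sum_const, nsmul_eq_mul, Finset.mul_sum, Finset.mul_sum]
    refine Finset.sum_le_sum fun i hi => ?_
    rw [← Finset.sum_filter, Finset.sum_const, nsmul_eq_mul]
    have h1 : (Finset.univ.filter fun x => x ∉ A i) = (A i)ᶜ := by ext; simp
    rw [h1, Finset.card_compl, Nat.cast_sub (Finset.card_le_univ _), Finset.card_univ, ← mul_assoc]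
    exact mul_le_mul_of_nonneg_right (by linarith [h i hi]) (hw i)
  obtain ⟨x, -, hx⟩ := Finset.exists_le_of_sum_le Finset.univ_nonempty key
  exact ⟨x, hx⟩

/-- The points `x n` are chosen by averaging on each level separately, and the inequalities are
added. -/
theorem exists_le_sum_filter_omitting {α β : ℝ} (F : Finset (Vertex α β))
    (w : Vertex α β → ℝ) (hw : ∀ a, 0 ≤ w a) :
    ∃ x : ∀ n : ℕ, Fin (n + 1),
      (1 - β) * ∑ a ∈ F, w a ≤ ∑ a ∈ F with x a.1 ∉ a.2.1, w a := by
  classical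
  have hex : ∀ n : ℕ, ∃ x : Fin (n + 1), (1 - β) * ∑ a ∈ F with a.1 = n, w a ≤
      ∑ a ∈ F with a.1 = n ∧ ∀ y : Fin (a.1 + 1), (y : ℕ) = x → y ∉ a.2.1, w a := by
    intro n
    let A : Vertex α β → Finset (Fin (n + 1)) := fun a =>
      Finset.univ.filter fun x => ∃ y : Fin (a.1 + 1), (y : ℕ) = x ∧ y ∈ a.2.1
    obtain ⟨x, hx⟩ := exists_le_sum_filter_notMem (F.filter fun a => a.1 = n) A w hw β (by
      rintro ⟨m, B⟩ ha
      obtain rfl : m = n := (Finset.mem_filter.1 ha).2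
      have : A ⟨m, B⟩ = B.1 := by
        ext z
        simp only [A, Finset.mem_filter, Finset.mem_univ, true_and]
        exact ⟨fun ⟨y, hy, hB⟩ => Fin.ext hy ▸ hB, fun hz => ⟨z, rfl, hz⟩⟩
      rw [this]
      exact B.2.2)
    refine ⟨x, hx.trans (le_of_eq ?_)⟩
    rw [Finset.filter_filter]
    refine Finset.sum_congr (Finset.filter_congr fun a _ => and_congr_right fun _ => ?_)
      fun _ _ => rfl
    simp [A]
  choose x hx using hex
  refine ⟨x, ?_⟩
  have hm : ∀ a ∈ F, a.1 ∈ F.image Sigma.fst := fun a ha => Finset.mem_image_of_mem _ ha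
  rw [← Finset.sum_fiberwise_of_maps_to hm w, Finset.mul_sum,
    ← Finset.sum_fiberwise_of_maps_to
      (fun a ha => hm a (Finset.mem_filter.1 ha).1) w]
  refine Finset.sum_le_sum fun n _ => (hx n).trans (le_of_eq ?_)
  rw [Finset.filter_filter]
  refine Finset.sum_congr (Finset.filter_congr fun a _ => ?_) fun _ _ => rfl
  constructor
  · rintro ⟨rfl, h⟩
    exact ⟨h _ rfl, rfl⟩
  · rintro ⟨h, rfl⟩
    exact ⟨rfl, fun y hy => Fin.ext hy ▸ h⟩

theorem IsLscSubmeasure.monotone {X : Type} {φ : Set X → ℝ≥0∞} (hφ : IsLscSubmeasure φ) :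
    Monotone φ := fun A B h => by
  have := hφ.mono A B
  rwa [Set.union_eq_self_of_subset_left h] at this

theorem IsLscSubmeasure.lt_top_of_finite {X : Type} {φ : Set X → ℝ≥0∞}
    (hφ : IsLscSubmeasure φ) {A : Set X} (hA : A.Finite) : φ A < ⊤ := by
  induction A, hA using Set.Finite.induction_on with
  | empty => simp [hφ.empty]
  | @insert a A _ _ ih =>
    rw [Set.insert_eq]
    exact (hφ.subadditive _ _).trans_lt (ENNReal.add_lt_top.2 ⟨hφ.singleton_lt_top a, ih⟩)

/-- A lower semicontinuous submeasure that is finite on all the sets `omitting x` is bounded on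
them, by the Baire category theorem. -/
theorem IsLscSubmeasure.exists_bound_omitting {α β : ℝ} {φ : Set (Vertex α β) → ℝ≥0∞}
    (hφ : IsLscSubmeasure φ) (h : ∀ x, φ (omitting x) < ⊤) :
    ∃ M : ℝ≥0∞, M < ⊤ ∧ ∀ x, φ (omitting x) ≤ M := by
  classical
  let f : ℕ → Set (∀ n : ℕ, Fin (n + 1)) := fun M => {x | φ (omitting x) ≤ M}
  have hclosed : ∀ M, IsClosed (f M) := by
    intro M
    -- By lower semicontinuity, a value above `M` is already reached on a finite `F`, so only
    -- finitely many coordinates of `x` matter.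
    have : f M = ⋂ (F : Finset (Vertex α β)) (_ : ¬ φ F ≤ M), ⋃ a ∈ F, {x | x a.1 ∈ a.2.1} := by
      ext x
      simp only [f, Set.mem_ofPred_eq, Set.mem_iInter, Set.mem_iUnion]
      rw [hφ.lsc, iSup₂_le_iff]
      refine forall_congr' fun F => ⟨fun hF hM => ?_, fun hF hsub => ?_⟩
      · by_contra hc
        push Not at hc
        exact hM (hF fun a ha => hc a ha)
      · by_contra hM
        obtain ⟨a, ha, hx⟩ := hF hM
        exact hsub ha hx
    rw [this]
    refine isClosed_iInter fun F => isClosed_iInter fun _ => ?_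
    refine F.finite_toSet.isClosed_biUnion fun a _ => ?_
    exact (isClosed_discrete ((a.2.1 : Finset (Fin (a.1 + 1))) : Set (Fin (a.1 + 1)))).preimage
      (continuous_apply a.1)
  have hunion : ⋃ M, f M = Set.univ := by
    refine Set.eq_univ_of_forall fun x => Set.mem_iUnion.2 ?_
    obtain ⟨M, hM⟩ := ENNReal.exists_nat_gt (h x).ne
    exact ⟨M, hM.le⟩
  -- By Baire, some `f M` contains a basic box, which restricts only the levels in the finite set
  -- `I`. Changing any `x` on `I` moves it into the box, at the price of the finite set `E` of
  -- vertices on those levels.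
  obtain ⟨M, x₀, hx₀⟩ := nonempty_interior_of_iUnion_of_closed hclosed hunion
  obtain ⟨I, u, hu, hI⟩ := isOpen_pi_iff.1 isOpen_interior x₀ hx₀
  let E : Set (Vertex α β) := {a | a.1 ∈ I}
  have hE : E.Finite := by
    have h2 : E ⊆ ⋃ n ∈ I, Set.range (Sigma.mk n) := fun a ha =>
      Set.mem_iUnion₂.2 ⟨a.1, ha, a.2, rfl⟩
    exact (I.finite_toSet.biUnion fun n _ => Set.finite_range _).subset h2
  refine ⟨M + φ E, ENNReal.add_lt_top.2 ⟨ENNReal.natCast_lt_top M, hφ.lt_top_of_finite hE⟩,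
    fun x => ?_⟩
  let y : ∀ n : ℕ, Fin (n + 1) := fun n => if n ∈ I then x₀ n else x n
  have hy : φ (omitting y) ≤ M := by
    have : y ∈ f M := interior_subset (hI fun n hn => by
      have hn' : n ∈ I := hn
      simpa [y, hn'] using (hu n hn').2)
    exact this
  have hsub : (omitting x : Set (Vertex α β)) ⊆ omitting y ∪ E := by
    intro a ha
    by_cases hI : a.1 ∈ I
    · exact Or.inr hI
    · refine Or.inl ?_
      simpa [omitting, y, hI] using ha
  exact (hφ.monotone hsub).trans ((hφ.subadditive _ _).trans (add_le_add_left hy _))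

theorem isSuperPathological_of_omitting_mem {α β : ℝ} (hβ : β < 1)
    {I : Set (Set (Vertex α β))} (hI : ∀ x, omitting x ∈ I) : IsSuperPathological I := by
  classical
  rintro J - - hJ hIJ ⟨φ, hφ, hnp, rfl⟩
  obtain ⟨M, hM, hφM⟩ := hφ.exists_bound_omitting fun x => hIJ (hI x)
  refine hJ (Set.eq_univ_of_forall fun A => ?_)
  -- By non-pathology it suffices to bound `μ F` for dominated `μ`; the averaged `x` gives `(1 - β)
  -- μ(F) ≤ φ (omitting x) ≤ M`.
  have hbound : ∀ F : Finset (Vertex α β), φ F ≤ M / ENNReal.ofReal (1 - β) := by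
    intro F
    rw [hnp F]
    refine iSup₂_le fun μ hμ => ?_
    let _ : MeasurableSpace (Vertex α β) := ⊤
    have _ : MeasurableSingletonClass (Vertex α β) := ⟨fun _ => trivial⟩
    let w : Vertex α β → ℝ := fun a => (μ {a}).toReal
    have hsum : ∀ G : Finset (Vertex α β), μ (G : Set (Vertex α β)) =
        ENNReal.ofReal (∑ a ∈ G, w a) := by
      intro G
      rw [ENNReal.ofReal_sum_of_nonneg fun _ _ => ENNReal.toReal_nonneg,
        ← MeasureTheory.sum_measure_singleton]
      exact Finset.sum_congr rfl fun a _ =>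
        (ENNReal.ofReal_toReal ((hμ _).trans_lt (hφ.singleton_lt_top a)).ne).symm
    obtain ⟨x, hx⟩ := exists_le_sum_filter_omitting F w fun _ => ENNReal.toReal_nonneg
    have hpos : 0 < 1 - β := by linarith
    rw [ENNReal.le_div_iff_mul_le (Or.inl (by simpa using hpos)) (Or.inl ENNReal.ofReal_ne_top),
      hsum, mul_comm, ← ENNReal.ofReal_mul hpos.le]
    refine (ENNReal.ofReal_le_ofReal hx).trans ?_
    rw [← hsum]
    refine (hμ _).trans ((hφ.monotone fun a ha => ?_).trans (hφM x))
    exact (Finset.mem_filter.1 ha).2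
  have huniv : φ A ≤ M / ENNReal.ofReal (1 - β) := by
    rw [hφ.lsc]
    exact iSup₂_le fun F _ => hbound F
  exact huniv.trans_lt (ENNReal.div_lt_top hM.ne (by simpa using hβ))

/-! ### Ramsey's theorem for finite sets -/

theorem exists_eventually_eq {ι κ : Type} [Finite κ] (U : Ultrafilter ι) (f : ι → κ) :
    ∃ i, ∀ᶠ n in (U : Filter ι), f n = i := by
  obtain ⟨i, hi⟩ := (U.map f).eq_pure_of_finite
  refine ⟨i, ?_⟩
  have h : ({i} : Set κ) ∈ U.map f := by rw [hi]; exact Ultrafilter.mem_pure.2 rfl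
  exact Ultrafilter.mem_map.1 h

theorem eventually_hyperfilter_ge (N : ℕ) :
    ∀ᶠ n in (Filter.hyperfilter ℕ : Filter ℕ), N ≤ n := by
  have h := Filter.eventually_ge_atTop (α := ℕ) N
  rw [← Nat.cofinite_eq_atTop] at h
  exact h.filter_mono Filter.hyperfilter_le_cofinite

/-- Ramsey's theorem for colorings of the `m`-element sets of natural numbers. -/
theorem exists_monochromatic_finset {κ : Type} [Finite κ] (c : Finset ℕ → κ) (m L : ℕ) :
    ∃ i, ∃ H : Finset ℕ, H.card = L ∧ ∀ s ⊆ H, s.card = m → c s = i := by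
  classical
  have hlim : ∀ g : Finset ℕ → κ, ∃ g' : Finset ℕ → κ, ∀ s,
      ∀ᶠ y in (Filter.hyperfilter ℕ : Filter ℕ), g (insert y s) = g' s := fun g => by
    choose g' hg' using fun s => exists_eventually_eq (Filter.hyperfilter ℕ) fun y => g (insert y s)
    exact ⟨g', hg'⟩
  choose lim hlim using hlim
  -- `g j s` is the iterated ultrafilter limit of `c` after `j` further points are added to `s`; `g
  -- m ∅` is the color sought.
  let g : ℕ → Finset ℕ → κ := fun j => lim^[j] c
  have hg : ∀ j s, ∀ᶠ y in (Filter.hyperfilter ℕ : Filter ℕ), g j (insert y s) = g (j + 1) s := by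
    intro j s
    have : g (j + 1) = lim (g j) := Function.iterate_succ_apply' lim j c
    rw [this]
    exact hlim _ s
  suffices h : ∃ H : Finset ℕ, H.card = L ∧ ∀ s ⊆ H, s.card ≤ m → g (m - s.card) s = g m ∅ by
    obtain ⟨H, hH, h⟩ := h
    refine ⟨g m ∅, H, hH, fun s hs hm => ?_⟩
    have := h s hs hm.le
    rwa [hm, Nat.sub_self] at this
  induction L with
  | zero =>
    refine ⟨∅, rfl, fun s hs _ => ?_⟩
    rw [Finset.subset_empty.1 hs]
    simp
  | succ L ih =>
    obtain ⟨H, hH, h⟩ := ih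
    -- A generic new point realizes the limits for all subsets of `H` at once, which preserves the
    -- invariant.
    have h1 : ∀ᶠ y in (Filter.hyperfilter ℕ : Filter ℕ), ∀ s ∈ H.powerset, s.card < m →
        g (m - (s.card + 1)) (insert y s) = g m ∅ := by
      rw [Filter.eventually_all_finset]
      intro s hs
      by_cases hsm : s.card < m
      · filter_upwards [hg (m - (s.card + 1)) s] with y hy _
        rw [hy, show m - (s.card + 1) + 1 = m - s.card by omega]
        exact h s (Finset.mem_powerset.1 hs) hsm.le
      · exact Filter.Eventually.of_forall fun y hy => absurd hy hsm
    obtain ⟨y, hy, hyH⟩ := (h1.and (eventually_hyperfilter_ge (H.sup id + 1))).exists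
    have hyn : y ∉ H := fun hy' => by
      have : id y ≤ H.sup id := Finset.le_sup hy'
      simp only [id] at this
      omega
    refine ⟨insert y H, by rw [Finset.card_insert_of_notMem hyn, hH], fun s hs hsm => ?_⟩
    by_cases hys : y ∈ s
    · have hcard := Finset.card_erase_add_one hys
      have := hy (s.erase y) (Finset.mem_powerset.2 (Finset.subset_insert_iff.1 hs)) (by omega)
      rwa [Finset.insert_erase hys, hcard] at this
    · exact h s ((Finset.subset_insert_iff_of_notMem hys).1 hs) hsm

/-! ### Sets of permutations determined by the position of the least value -/

/-- The number of elements of `s` below `t`. -/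
def rank (s : Finset ℕ) (t : ℕ) : ℕ := (s.filter (· < t)).card

theorem rank_strictMonoOn (s : Finset ℕ) : StrictMonoOn (rank s) s := by
  intro a ha b _ hab
  refine Finset.card_lt_card (Finset.ssubset_iff_of_subset ?_ |>.2 ⟨a, ?_, ?_⟩)
  · exact fun x hx => Finset.mem_filter.2
      ⟨(Finset.mem_filter.1 hx).1, (Finset.mem_filter.1 hx).2.trans hab⟩
  · exact Finset.mem_filter.2 ⟨ha, hab⟩
  · simp

theorem image_rank (s : Finset ℕ) : s.image (rank s) = Finset.range s.card := by
  refine Finset.eq_of_subset_of_card_le (fun j hj => ?_) ?_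
  · obtain ⟨t, ht, rfl⟩ := Finset.mem_image.1 hj
    refine Finset.mem_range.2 (Finset.card_lt_card (Finset.filter_ssubset.2 ⟨t, ht, by simp⟩))
  · rw [Finset.card_range, Finset.card_image_of_injOn (rank_strictMonoOn s).injOn]

theorem card_filter_rank (s : Finset ℕ) (P : ℕ → Prop) [DecidablePred P] :
    (s.filter fun t => P (rank s t)).card = ((Finset.range s.card).filter P).card := by
  rw [← image_rank, Finset.filter_image, Finset.card_image_of_injOn]
  exact (rank_strictMonoOn s).injOn.mono fun t ht => (Finset.mem_filter.1 ht).1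

/-- The permutations of `Fin N` that take their least value on `s` in the point `t`. -/
def minAt (N : ℕ) (s : Finset ℕ) (t : Fin N) : Finset (Equiv.Perm (Fin N)) :=
  {σ | ∀ y : Fin N, (y : ℕ) ∈ s → σ t ≤ σ y}

/-- Composing with the transposition of `t` and `u` is injective and moves the place of the minimum.
-/
theorem card_minAt_le {N : ℕ} {s : Finset ℕ} {t u : Fin N} (ht : (t : ℕ) ∈ s) (hu : (u : ℕ) ∈ s) :
    (minAt N s t).card ≤ (minAt N s u).card := by
  refine Finset.card_le_card_of_injOn (fun σ => σ * Equiv.swap t u) (fun σ hσ => ?_)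
    (fun σ _ τ _ h => mul_right_cancel h)
  have hσ' : ∀ y : Fin N, (y : ℕ) ∈ s → σ t ≤ σ y := by simpa [minAt] using hσ
  simp only [minAt, Finset.coe_filter, Finset.mem_univ, true_and, Set.mem_ofPred_eq,
    Equiv.Perm.coe_mul, Function.comp_apply, Equiv.swap_apply_right]
  intro y hy
  refine hσ' _ ?_
  rw [Equiv.swap_apply_def]
  split_ifs <;> assumption

theorem disjoint_minAt {N : ℕ} {s : Finset ℕ} {t u : Fin N} (ht : (t : ℕ) ∈ s)
    (hu : (u : ℕ) ∈ s) (h : t ≠ u) : Disjoint (minAt N s t) (minAt N s u) := by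
  refine Finset.disjoint_left.2 fun σ h1 h2 => h (σ.injective (le_antisymm ?_ ?_))
  · exact (Finset.mem_filter.1 h1).2 u hu
  · exact (Finset.mem_filter.1 h2).2 t ht

/-- The permutations whose least value on `s` is taken at a point with rank in `P`. -/
def minRank (P : ℕ → Prop) [DecidablePred P] (N : ℕ) (s : Finset ℕ) :
    Finset (Equiv.Perm (Fin N)) :=
  (Finset.univ.filter fun t : Fin N => (t : ℕ) ∈ s ∧ P (rank s t)).biUnion (minAt N s)

/-- The minimum is equally likely at each point of `s`, so the proportion of permutations is that of
the ranks in `P`. Taking `P` always true evaluates the common count. -/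
theorem card_minRank {N : ℕ} {s : Finset ℕ} (hs : s ⊆ Finset.range N) (hne : s.Nonempty)
    (P : ℕ → Prop) [DecidablePred P] :
    s.card * (minRank P N s).card = ((Finset.range s.card).filter P).card * N.factorial := by
  obtain ⟨t₀, ht₀⟩ := hne
  let u : Fin N := ⟨t₀, Finset.mem_range.1 (hs ht₀)⟩
  have hcard : ∀ t : Fin N, (t : ℕ) ∈ s → (minAt N s t).card = (minAt N s u).card :=
    fun t ht => le_antisymm (card_minAt_le ht ht₀) (card_minAt_le ht₀ ht)
  have hfilter : ∀ (Q : ℕ → Prop) [DecidablePred Q],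
      (Finset.univ.filter fun t : Fin N => (t : ℕ) ∈ s ∧ Q t).card = (s.filter Q).card := by
    intro Q _
    refine Finset.card_bij (fun t _ => (t : ℕ)) (fun t ht => ?_) (fun _ _ _ _ h => Fin.ext h)
      fun t ht => ?_
    · exact Finset.mem_filter.2 (Finset.mem_filter.1 ht).2
    · have h := Finset.mem_filter.1 ht
      exact ⟨⟨t, Finset.mem_range.1 (hs h.1)⟩, Finset.mem_filter.2 ⟨Finset.mem_univ _, h⟩, rfl⟩
  have hP : ∀ (Q : ℕ → Prop) [DecidablePred Q], (minRank Q N s).card =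
      ((Finset.range s.card).filter Q).card * (minAt N s u).card := by
    intro Q _
    unfold minRank
    rw [Finset.card_biUnion]
    · rw [Finset.sum_congr rfl fun t ht => hcard t (Finset.mem_filter.1 ht).2.1,
        Finset.sum_const, smul_eq_mul, hfilter fun t => Q (rank s t), card_filter_rank]
    · exact fun t ht t' ht' h => disjoint_minAt (Finset.mem_filter.1 ht).2.1
        (Finset.mem_filter.1 ht').2.1 h
  have htot : minRank (fun _ => True) N s = Finset.univ := by
    refine Finset.eq_univ_of_forall fun σ => ?_
    obtain ⟨t, ht, hmin⟩ := Finset.exists_min_image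
      (Finset.univ.filter fun t : Fin N => (t : ℕ) ∈ s) σ ⟨u, by simp [u, ht₀]⟩
    refine Finset.mem_biUnion.2 ⟨t, by simpa using ht, ?_⟩
    exact Finset.mem_filter.2 ⟨Finset.mem_univ _, fun y hy => hmin y (by simp [hy])⟩
  have h1 := hP fun _ => True
  rw [htot, Finset.card_univ, Fintype.card_perm, Fintype.card_fin] at h1
  simp only [Finset.filter_true, Finset.card_range] at h1
  rw [hP P, h1]
  ring

/-- The positions that are divisible by `p` or among the last `p` of `m`. -/
def goodRank (p m j : ℕ) : Prop := p ∣ j ∨ m ≤ j + p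

instance (p m : ℕ) : DecidablePred (goodRank p m) := fun j => by
  unfold goodRank; infer_instance

theorem le_card_goodRank {p q : ℕ} (hp : 0 < p) :
    q ≤ ((Finset.range (p * q)).filter (goodRank p (p * q))).card := by
  have h : (Finset.range q).image (p * ·) ⊆
      (Finset.range (p * q)).filter (goodRank p (p * q)) := by
    intro j hj
    obtain ⟨i, hi, rfl⟩ := Finset.mem_image.1 hj
    refine Finset.mem_filter.2 ⟨Finset.mem_range.2 ?_, Or.inl (Dvd.intro _ rfl)⟩
    exact Nat.mul_lt_mul_of_pos_left (Finset.mem_range.1 hi) hp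
  have := Finset.card_le_card h
  rwa [Finset.card_image_of_injective _ (mul_right_injective₀ hp.ne'),
    Finset.card_range] at this

theorem card_goodRank_le {p q : ℕ} :
    ((Finset.range (p * q)).filter (goodRank p (p * q))).card ≤ q + p := by
  have h : (Finset.range (p * q)).filter (goodRank p (p * q)) ⊆
      (Finset.range q).image (p * ·) ∪ Finset.Ico (p * q - p) (p * q) := by
    intro j hj
    obtain ⟨hj, h | h⟩ := Finset.mem_filter.1 hj
    · obtain ⟨i, rfl⟩ := h
      refine Finset.mem_union_left _ (Finset.mem_image.2 ⟨i, Finset.mem_range.2 ?_, rfl⟩)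
      exact lt_of_mul_lt_mul_left (Finset.mem_range.1 hj) (Nat.zero_le p)
    · refine Finset.mem_union_right _ (Finset.mem_Ico.2 ⟨?_, Finset.mem_range.1 hj⟩)
      omega
  refine (Finset.card_le_card h).trans ((Finset.card_union_le _ _).trans ?_)
  refine add_le_add (Finset.card_image_le.trans (by simp)) ?_
  rw [Nat.card_Ico]
  omega

/-- Between `q` and `q + p` of the `p * q` ranks are good, and `p ≤ δ q` absorbs the excess. -/
theorem card_minRank_mem {p q N : ℕ} {δ : ℝ} (hp : 0 < p) (hδ : 0 ≤ δ) (hq : 0 < q)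
    (hpq : (p : ℝ) ≤ δ * q) {s : Finset ℕ} (hs : s ⊆ Finset.range N) (hcard : s.card = p * q) :
    (1 - δ) / p * N.factorial ≤ (minRank (goodRank p (p * q)) N s).card ∧
      ((minRank (goodRank p (p * q)) N s).card : ℝ) ≤ (1 + δ) / p * N.factorial := by
  have hne : s.Nonempty := by
    rw [← Finset.card_pos, hcard]; positivity
  have h := card_minRank hs hne (goodRank p (p * q))
  rw [hcard] at h
  have hR : ((p : ℝ) * q) * (minRank (goodRank p (p * q)) N s).card =
      ((Finset.range (p * q)).filter (goodRank p (p * q))).card * N.factorial := by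
    exact_mod_cast h
  have hl : (q : ℝ) ≤ ((Finset.range (p * q)).filter (goodRank p (p * q))).card := by
    exact_mod_cast le_card_goodRank hp
  have hu : (((Finset.range (p * q)).filter (goodRank p (p * q))).card : ℝ) ≤ q + p := by
    exact_mod_cast card_goodRank_le
  generalize (((Finset.range (p * q)).filter (goodRank p (p * q))).card : ℝ) = g at *
  generalize ((minRank (goodRank p (p * q)) N s).card : ℝ) = a at *
  have hp' : (0 : ℝ) < p := by exact_mod_cast hp
  have hq' : (0 : ℝ) < q := by exact_mod_cast hq
  have hN : (0 : ℝ) < N.factorial := by exact_mod_cast N.factorial_pos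
  constructor
  · rw [div_mul_eq_mul_div, div_le_iff₀ hp']
    refine le_of_mul_le_mul_left ?_ hq'
    calc (q : ℝ) * ((1 - δ) * N.factorial) ≤ q * N.factorial := by
          nlinarith [mul_nonneg (mul_nonneg hq'.le hδ) hN.le]
      _ ≤ g * N.factorial := mul_le_mul_of_nonneg_right hl hN.le
      _ = q * (a * p) := by rw [← hR]; ring
  · rw [div_mul_eq_mul_div, le_div_iff₀ hp']
    refine le_of_mul_le_mul_left ?_ hq'
    calc (q : ℝ) * (a * p) = g * N.factorial := by rw [← hR]; ring
      _ ≤ (q + δ * q) * N.factorial := mul_le_mul_of_nonneg_right (by linarith) hN.le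
      _ = q * ((1 + δ) * N.factorial) := by ring

theorem rank_image_Ico {a : ℕ → ℕ} {L i m t : ℕ} (ha : StrictMonoOn a (Set.Iio L))
    (hL : i + m ≤ L) (ht : t < i + m) :
    rank ((Finset.Ico i (i + m)).image a) (a t) = t - i := by
  have h : ((Finset.Ico i (i + m)).image a).filter (· < a t) = (Finset.Ico i t).image a := by
    ext y
    simp only [Finset.mem_filter, Finset.mem_image, Finset.mem_Ico]
    constructor
    · rintro ⟨⟨j, hj, rfl⟩, hlt⟩
      refine ⟨j, ⟨hj.1, ?_⟩, rfl⟩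
      exact (ha.lt_iff_lt (Set.mem_Iio.2 (by omega)) (Set.mem_Iio.2 (by omega))).1 hlt
    · rintro ⟨j, hj, rfl⟩
      exact ⟨⟨j, ⟨hj.1, by omega⟩, rfl⟩,
        ha (Set.mem_Iio.2 (by omega)) (Set.mem_Iio.2 (by omega)) hj.2⟩
  rw [rank, h, Finset.card_image_of_injOn, Nat.card_Ico]
  exact ha.injOn.mono fun j hj => by
    have := Finset.mem_Ico.1 (Finset.mem_coe.1 hj)
    exact Set.mem_Iio.2 (by omega)

/-- Among `p` consecutive windows of length `m`, one takes its least value at a good position. -/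
theorem exists_mem_minRank_window {p m N : ℕ} (hp : 0 < p) (hpm : p ≤ m) {a : ℕ → ℕ}
    (ha : StrictMonoOn a (Set.Iio (m + p))) (haN : ∀ j < m + p, a j < N)
    (σ : Equiv.Perm (Fin N)) :
    ∃ i < p, σ ∈ minRank (goodRank p m) N ((Finset.Ico i (i + m)).image a) := by
  -- The `p` windows together occupy the positions below `m + p - 1`; `t` is the position of the
  -- overall minimum.
  obtain ⟨t, ht, hmin⟩ := Finset.exists_min_image (Finset.univ : Finset (Fin (m + p - 1)))
    (fun j => σ ⟨a j, haN j (by omega)⟩) ⟨⟨0, by omega⟩, Finset.mem_univ _⟩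
  have key : ∀ i < p, i ≤ t → (t : ℕ) < i + m → goodRank p m (t - i) →
      σ ∈ minRank (goodRank p m) N ((Finset.Ico i (i + m)).image a) := by
    intro i hi hit hti hgood
    refine Finset.mem_biUnion.2 ⟨⟨a t, haN t (by omega)⟩, ?_, ?_⟩
    · refine Finset.mem_filter.2 ⟨Finset.mem_univ _, ?_, ?_⟩
      · exact Finset.mem_image_of_mem _ (Finset.mem_Ico.2 ⟨hit, hti⟩)
      · rw [rank_image_Ico ha (by omega) hti]
        exact hgood
    · refine Finset.mem_filter.2 ⟨Finset.mem_univ _, fun y hy => ?_⟩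
      obtain ⟨j, hj, hjy⟩ := Finset.mem_image.1 hy
      have hj' := Finset.mem_Ico.1 hj
      have h := hmin ⟨j, by omega⟩ (Finset.mem_univ _)
      have e : (⟨a j, haN j (by omega)⟩ : Fin N) = y := Fin.ext hjy
      simpa only [e] using h
  by_cases h : (t : ℕ) < m
  -- The window starting at `t % p` sees `t` at a rank divisible by `p`.
  · refine ⟨t % p, Nat.mod_lt _ hp, key _ (Nat.mod_lt _ hp) (Nat.mod_le _ _) (by omega) ?_⟩
    exact Or.inl (Nat.dvd_sub_mod _)
  -- For `t ≥ m` the last window sees `t` among its last `p` ranks.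
  · refine ⟨p - 1, by omega, key _ (by omega) (by omega) (by omega) (Or.inr ?_)⟩
    omega

/-! ### Non-triviality -/

/-- A numbering of the permutations of `Fin N`. -/
noncomputable def permEquiv (N : ℕ) : Equiv.Perm (Fin N) ≃ Fin (N.factorial - 1 + 1) :=
  Fintype.equivFinOfCardEq (by
    rw [Fintype.card_perm, Fintype.card_fin, Nat.sub_add_cancel N.factorial_pos])

theorem map_minRank_mem_cardInterval {p q N : ℕ} {δ : ℝ} (hp : 0 < p) (hδ : 0 ≤ δ) (hq : 0 < q)
    (hpq : (p : ℝ) ≤ δ * q) {s : Finset ℕ} (hs : s ⊆ Finset.range N) (hcard : s.card = p * q) :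
    (minRank (goodRank p (p * q)) N s).map (permEquiv N).toEmbedding ∈
      cardInterval (Fin (N.factorial - 1 + 1)) ((1 - δ) / p) ((1 + δ) / p) := by
  have h := card_minRank_mem hp hδ hq hpq hs hcard
  unfold cardInterval
  rw [Set.mem_ofPred_eq, Finset.card_map, Fintype.card_fin, Nat.sub_add_cancel N.factorial_pos]
  exact h

theorem sUnion_coverFree_ne_univ {p : ℕ} (hp : 0 < p) {δ : ℝ} (hδ : 0 < δ)
    (S : Finset (Set (Vertex ((1 - δ) / p) ((1 + δ) / p)))) (hS : ∀ B ∈ S, CoverFree (p + 1) B) :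
    ⋃₀ (S : Set (Set (Vertex ((1 - δ) / p) ((1 + δ) / p)))) ≠ Set.univ := by
  classical
  intro hU
  -- The summand 1 keeps `q` positive; the rest gives `p ≤ δ q`.
  obtain ⟨q, hq⟩ := exists_nat_ge ((p : ℝ) / δ + 1)
  have hpq : (p : ℝ) ≤ δ * q := by
    have : (p : ℝ) / δ ≤ q := by linarith
    rwa [div_le_iff₀ hδ, mul_comm] at this
  have hq0 : 0 < q := by
    have : (0 : ℝ) < q := lt_of_lt_of_le (by positivity) hq
    exact_mod_cast this
  set m := p * q with hm
  have hpm : p ≤ m := Nat.le_mul_of_pos_right p hq0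
  -- Level `n` has `n + 1` points, so the `N!` permutations live on level `N! - 1`.
  let v : ∀ (N : ℕ) (s : Finset ℕ), s ⊆ Finset.range N ∧ s.card = m →
      Vertex ((1 - δ) / p) ((1 + δ) / p) := fun N s h =>
    ⟨N.factorial - 1, (minRank (goodRank p m) N s).map (permEquiv N).toEmbedding,
      map_minRank_mem_cardInterval hp hδ.le hq0 hpq h.1 h.2⟩
  have hfst : ∀ N s h, (v N s h).1 = N.factorial - 1 := fun _ _ _ => rfl
  have hne : Nonempty S := by
    have : ∃ B, B ∈ S := by
      obtain ⟨B, hB, -⟩ : v m (Finset.range m) ⟨subset_rfl, by simp⟩ ∈ ⋃₀ (S : Set (Set _)) :=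
        hU ▸ Set.mem_univ _
      exact ⟨B, hB⟩
    obtain ⟨B, hB⟩ := this
    exact ⟨⟨B, hB⟩⟩
  have hcol : ∀ (s : Finset ℕ) (N : ℕ), ∃ B : S, ∀ h, v N s h ∈ B.1 := by
    intro s N
    by_cases h : s ⊆ Finset.range N ∧ s.card = m
    · obtain ⟨B, hB, hvB⟩ : v N s h ∈ ⋃₀ (S : Set (Set _)) := hU ▸ Set.mem_univ _
      exact ⟨⟨B, hB⟩, fun _ => hvB⟩
    · exact ⟨hne.some, fun h' => absurd h' h⟩
  choose col hcol using hcol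
  -- The limit color as `N` grows depends on `s` alone, so Ramsey's theorem applies to it.
  choose c hc using fun s => exists_eventually_eq (Filter.hyperfilter ℕ) (col s)
  obtain ⟨B, H, hH, hmono⟩ := exists_monochromatic_finset c m (m + p)
  let a : ℕ → ℕ := fun j => if h : j < m + p then H.orderEmbOfFin hH ⟨j, h⟩ else 0
  have haH : ∀ j < m + p, a j ∈ H := fun j hj => by
    simp only [a, hj, dif_pos]
    exact Finset.orderEmbOfFin_mem H hH _
  have ha : StrictMonoOn a (Set.Iio (m + p)) := by
    intro i hi j hj hij
    simp only [a, Set.mem_Iio.1 hi, Set.mem_Iio.1 hj, dif_pos]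
    exact (H.orderEmbOfFin hH).strictMono hij
  let w : ℕ → Finset ℕ := fun i => (Finset.Ico i (i + m)).image a
  have hwH : ∀ i < p, w i ⊆ H := fun i hi y hy => by
    obtain ⟨j, hj, rfl⟩ := Finset.mem_image.1 hy
    exact haH j (by have := Finset.mem_Ico.1 hj; omega)
  have hwcard : ∀ i < p, (w i).card = m := fun i hi => by
    rw [Finset.card_image_of_injOn, Nat.card_Ico, Nat.add_sub_cancel_left]
    exact ha.injOn.mono fun j hj => by
      have := Finset.mem_Ico.1 (Finset.mem_coe.1 hj)
      exact Set.mem_Iio.2 (by omega)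
  have hev : ∀ᶠ N in (Filter.hyperfilter ℕ : Filter ℕ), ∀ i ∈ Finset.range p, col (w i) N = B := by
    rw [Filter.eventually_all_finset]
    intro i hi
    have hi' := Finset.mem_range.1 hi
    filter_upwards [hc (w i)] with N hN
    rw [hN, hmono (w i) (hwH i hi') (hwcard i hi')]
  -- The cover found below may have fewer than `p + 1` members and must be padded inside `B`. A
  -- finite `B` does not allow this, but it misses all levels beyond `N₀`.
  have hfin : ∃ N₀, B.1.Finite → ∀ b ∈ B.1, b.1 + 1 < N₀ := by
    by_cases hB : B.1.Finite
    · obtain ⟨N₀, hN₀⟩ := (hB.image fun b => b.1 + 2).bddAbove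
      exact ⟨N₀, fun _ b hb => hN₀ ⟨b, hb, rfl⟩⟩
    · exact ⟨0, fun h => absurd h hB⟩
  obtain ⟨N₀, hN₀⟩ := hfin
  obtain ⟨N, ⟨hN, hNN₀⟩, hNH⟩ := ((hev.and (eventually_hyperfilter_ge N₀)).and
    (eventually_hyperfilter_ge (H.sup id + 1))).exists
  have hHN : ∀ y ∈ H, y < N := fun y hy => by
    have : id y ≤ H.sup id := Finset.le_sup hy
    simp only [id] at this
    omega
  have hw : ∀ i : Fin p, w i ⊆ Finset.range N ∧ (w i).card = m := fun i =>
    ⟨fun y hy => Finset.mem_range.2 (hHN y (hwH i i.2 hy)), hwcard i i.2⟩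
  let T : Finset (Vertex ((1 - δ) / p) ((1 + δ) / p)) :=
    Finset.univ.image fun i : Fin p => v N (w i) (hw i)
  have hTB : (T : Set (Vertex ((1 - δ) / p) ((1 + δ) / p))) ⊆ B.1 := by
    intro b hb
    obtain ⟨i, -, rfl⟩ := Finset.mem_image.1 (Finset.mem_coe.1 hb)
    have := hcol (w i) N (hw i)
    rwa [hN i (Finset.mem_range.2 i.2)] at this
  have hvT : ∀ i : Fin p, v N (w i) (hw i) ∈ T := fun i =>
    Finset.mem_image_of_mem (fun i : Fin p => v N (w i) (hw i)) (Finset.mem_univ i)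
  have hTcov : Covers (T : Set (Vertex ((1 - δ) / p) ((1 + δ) / p))) := by
    refine ⟨N.factorial - 1, fun x => ?_⟩
    obtain ⟨i, hi, hmem⟩ := exists_mem_minRank_window hp hpm ha
      (fun j hj => hHN _ (haH j hj)) ((permEquiv N).symm x)
    refine ⟨(v N (w i) (hw ⟨i, hi⟩)).2, hvT ⟨i, hi⟩, ?_⟩
    exact Finset.mem_map.2 ⟨_, hmem, (permEquiv N).apply_symm_apply x⟩
  have hTcard : T.card ≤ p + 1 :=
    Finset.card_image_le.trans (by simp)
  by_cases hB : B.1.Finite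
  · have hmem : v N (w 0) (hw ⟨0, hp⟩) ∈ B.1 :=
      hTB (Finset.mem_coe.2 (hvT ⟨0, hp⟩))
    have h := hN₀ hB _ hmem
    rw [hfst N (w 0) (hw ⟨0, hp⟩)] at h
    have := N.self_le_factorial
    omega
  -- Padding the cover to exactly `p + 1` elements of `B` contradicts cover-freeness.
  · obtain ⟨R, hTR, hRB, hR⟩ := Set.Infinite.exists_superset_ncard_eq hB hTB T.finite_toSet
      (k := p + 1) (by rwa [Set.ncard_coe_finset])
    obtain ⟨R, rfl⟩ := (Set.finite_of_ncard_ne_zero (by omega : R.ncard ≠ 0)).exists_finset_coe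
    rw [Set.ncard_coe_finset] at hR
    exact hS B.1 B.2 R hR hRB (hTcov.mono hTR)

end ColoringIdeals

open ColoringIdeals in
theorem mainTheorem5 (p : ℕ) (hp : 2 ≤ p) (δ : ℝ) (hδ0 : 0 < δ) (hδ1 : δ < 1) :
    (IsNontrivial (coloringIdeal (symmetricMazurColoring p δ)) ∧
      IsSuperPathological (coloringIdeal (symmetricMazurColoring p δ))) ∧
    IsUniform (mazurHypergraph p δ) (p + 1) ∧
    (∃ k : ℕ, ForbidsComplete (mazurHypergraph p δ) (p + 1) k) ∧
    (IsIdeal (hypergraphIdeal (mazurHypergraph p δ) (p + 1)) ∧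
      IsFSigma (hypergraphIdeal (mazurHypergraph p δ) (p + 1)) ∧
      IsNontrivial (hypergraphIdeal (mazurHypergraph p δ) (p + 1)) ∧
      IsSuperPathological (hypergraphIdeal (mazurHypergraph p δ) (p + 1))) := by
  have hp' : (2 : ℝ) ≤ p := by exact_mod_cast hp
  have hβ : (1 + δ) / p < 1 := by
    rw [div_lt_one (by linarith)]
    linarith
  have hmem := fun A => mem_hypergraphIdeal_iff (A := A) (show 1 ≤ p by omega) hβ
  have hnt : IsNontrivial (hypergraphIdeal (mazurHypergraph p δ) (p + 1)) := by
    intro h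
    obtain ⟨S, hS, hU⟩ := (hmem Set.univ).1 (h ▸ Set.mem_univ _)
    exact sUnion_coverFree_ne_univ (by omega) hδ0 S hS (Set.univ_subset_iff.1 hU)
  have hsp : IsSuperPathological (hypergraphIdeal (mazurHypergraph p δ) (p + 1)) :=
    isSuperPathological_of_omitting_mem hβ fun x =>
      subset_generatedIdeal _ (Or.inr (isIndependent_iff_coverFree.2 (coverFree_omitting _ x)))
  have hF : IsFSigma (hypergraphIdeal (mazurHypergraph p δ) (p + 1)) := by
    rw [show hypergraphIdeal (mazurHypergraph p δ) (p + 1) = _ from Set.ext hmem]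
    exact isFSigma_finite_unions (p + 1)
  rw [coloringIdeal_symmetricMazurColoring]
  exact ⟨⟨hnt, hsp⟩, isUniform_mazurHypergraph p δ, exists_forbidsComplete hβ,
    isIdeal_generatedIdeal _, hF, hnt, hsp⟩
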